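/- Let $\Omega=\{1,\dots,n\}$ and let $\mu:2^\Omega\to[0,1]$ be a 2-monotone lower probability, i.e. $\mu(\emptyset)=0$, $\mu(\Omega)=1$, $\mu(A)\le\mu(B)$ for $A\subseteq B$, and $\mu(A)+\mu(B)\le\mu(A\cup B)+\mu(A\cap B)$ for all $A,B\subseteq\Omega$. Let $\bar\mu(A)=1-\mu(\Omega\setminus A)$ be its dual, $\mathcal P(\mu)=\{p : p_i\ge 0,\ \sum_i p_i=1,\ \sum_{i\in A}p_i\ge\mu(A)\ \forall A\subseteq\Omega\}$ its credal set, and $\mathrm{UE}(\mu)=\max_{p\in\mathcal P(\mu)}H(p)$ its upper entropy, where $H(p)=-\sum_i p_i\log p_i$ and $0\log 0=0$. The decomposition algorithm with input $(\bar\mu,\mathbf 1)$ is the recursive procedure $\mathrm{DA}$, started as $\mathrm{DA}(\emptyset,\Omega)$: on $(S,S')$ it puts $\alpha=\frac{\bar\mu(S')-\bar\mu(S)}{|S'\setminus S|}$ and calls a submodular-function-minimization (SFM) oracle for a minimizer $S''$ of largest cardinality of $A\mapsto\bar\mu(A)-\alpha|A|$ over all $A\subseteq\Omega$; if $S''=S'$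 it returns $\{S,S'\}$, and otherwise it returns $\mathrm{DA}(S,S'')\cup\mathrm{DA}(S'',S')$. Then: 1. The algorithm terminates, all functions submitted to the oracle are submodular, and the number of SFM calls is $O(n)$: it is at most $Cn$ for a universal constant $C$. 2. Its output is a chain $\{S_0,\dots,S_l\}$, $\emptyset=S_0\subset S_1\subset\cdots\subset S_l=\Omega$ (strict inclusions), for which there are breakpoints $0=\alpha_0\le\alpha_1<\cdots<\alpha_l<\alpha_{l+1}=+\infty$ such that, for every $j\in\{0,\dots,l\}$ and every real $\alpha\in[\alpha_j,\alpha_{j+1})$, $S_j$ is the unique minimizer of largest cardinality of $A\mapsto\bar\mu(A)-\alpha|A|$. Moreover $\alpha_1>0$ if $\bar\mu(\{i\})>0$ for all $i\in\Omega$. 3. The vector $p$ given by $p_i=\frac{\bar\mu(S_j)-\bar\mu(S_{j-1})}{|S_j\setminus S_{j-1}|}$ for $i\in S_j\setminus S_{j-1}$, $1\le j\le l$, lies in $\mathcal P(\mu)$ and is the unique maximizer of $H$ over $\mathcal P(\mu)$; in particular $\mathrm{UE}(\mu)=H(p)$. -/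

import Mathlib

open Finset

/-- A real set function on `Ω = Fin n` that vanishes at `∅` and is submodular. -/
def IsSubmodular {n : ℕ} (f : Finset (Fin n) → ℝ) : Prop :=
  f ∅ = 0 ∧ ∀ A B : Finset (Fin n), f (A ∪ B) + f (A ∩ B) ≤ f A + f B

/-- Supermodular: the negative is submodular. -/
def IsSupermodular {n : ℕ} (f : Finset (Fin n) → ℝ) : Prop :=
  IsSubmodular fun A => -f A

/-- Lower probabilities on `Fin n`: normalized monotone set functions with values in `[0, 1]`. -/
structure IsLowerProbability {n : ℕ} (μ : Finset (Fin n) → ℝ) : Prop where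
  mem_Icc : ∀ A, μ A ∈ Set.Icc (0 : ℝ) 1
  map_univ : μ univ = 1
  map_empty : μ ∅ = 0
  mono : ∀ A B, A ⊆ B → μ A ≤ μ B

/-- A 2-monotone lower probability. -/
structure IsTwoMonotone {n : ℕ} (μ : Finset (Fin n) → ℝ) : Prop where
  isLowerProbability : IsLowerProbability μ
  isSupermodular : IsSupermodular μ

/-- The dual (upper probability) of `μ`. -/
def dualProb {n : ℕ} (μ : Finset (Fin n) → ℝ) (A : Finset (Fin n)) : ℝ :=
  1 - μ Aᶜ

/-- The credal set of `μ`: the probability vectors dominating `μ` on every event. -/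
def credalSet {n : ℕ} (μ : Finset (Fin n) → ℝ) : Set (Fin n → ℝ) :=
  {p | p ∈ stdSimplex ℝ (Fin n) ∧ ∀ A : Finset (Fin n), μ A ≤ ∑ i ∈ A, p i}

/-- Shannon entropy `-∑ p_i log p_i` (with `0 log 0 = 0`). -/
noncomputable def shannonEntropy {n : ℕ} (p : Fin n → ℝ) : ℝ :=
  -∑ i, p i * Real.log (p i)

/-- The upper entropy: the largest entropy over the credal set. -/
noncomputable def upperEntropy {n : ℕ} (μ : Finset (Fin n) → ℝ) : ℝ :=
  sSup (shannonEntropy '' credalSet μ)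

/-- `A` minimizes `f` over all subsets of `Fin n`. -/
def IsMinimizer {n : ℕ} (f : Finset (Fin n) → ℝ) (A : Finset (Fin n)) : Prop :=
  ∀ B, f A ≤ f B

/-- `A` is a minimizer of `f` of largest cardinality. -/
def IsLargestMinimizer {n : ℕ} (f : Finset (Fin n) → ℝ) (A : Finset (Fin n)) : Prop :=
  IsMinimizer f A ∧ ∀ B, IsMinimizer f B → B.card ≤ A.card

/-- An oracle for submodular function minimization: on every submodular `f` it answers with a
minimizer of largest cardinality. Nothing is required on other inputs. -/
def IsSFMOracle {n : ℕ} (O : (Finset (Fin n) → ℝ) → Finset (Fin n)) : Prop :=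
  ∀ f, IsSubmodular f → IsLargestMinimizer f (O f)

/-- The set function `A ↦ ν(A) - α ∑_{i ∈ A} b_i`. -/
def shifted {n : ℕ} (ν : Finset (Fin n) → ℝ) (b : Fin n → ℝ) (α : ℝ)
    (A : Finset (Fin n)) : ℝ :=
  ν A - α * ∑ i ∈ A, b i

/-- The recursive procedure `DA(S, S')` of the decomposition algorithm for `ν` and `b`, run with
the minimization oracle `O`. The first argument bounds the recursion depth, and `none` means that
the bound was exceeded. On termination it returns the computed family of sets and the list of the
functions submitted to the oracle, one entry for every call. -/
noncomputable def decomposition {n : ℕ} (O : (Finset (Fin n) → ℝ) → Finset (Fin n))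
    (ν : Finset (Fin n) → ℝ) (b : Fin n → ℝ) :
    ℕ → Finset (Fin n) → Finset (Fin n) →
      Option (Finset (Finset (Fin n)) × List (Finset (Fin n) → ℝ))
  | 0, _, _ => none
  | k + 1, S, S' =>
    let α := (ν S' - ν S) / ∑ i ∈ S' \ S, b i
    let f := shifted ν b α
    let S'' := O f
    if S'' = S' then some ({S, S'}, [f])
    else
      (decomposition O ν b k S S'').bind fun r =>
        (decomposition O ν b k S'' S').bind fun r' =>
          some (r.1 ∪ r'.1, f :: (r.2 ++ r'.2))

/-- `∅ = S_0 ⊂ ⋯ ⊂ S_l = Ω` with breakpoints `0 = α_0 ≤ α_1 < ⋯ < α_l < α_{l+1} = +∞` such that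
for every `t` in `[α_j, α_{j+1})` the set `S_j` is the unique minimizer of largest cardinality of
`A ↦ ν(A) - t ∑_{i ∈ A} b_i`. Only the values `S j`, `α j` with `j ≤ l` matter. -/
structure IsDecompositionChain {n : ℕ} (ν : Finset (Fin n) → ℝ) (b : Fin n → ℝ)
    (l : ℕ) (S : ℕ → Finset (Fin n)) (α : ℕ → ℝ) : Prop where
  S_zero : S 0 = ∅
  S_last : S l = univ
  S_ssubset : ∀ j < l, S j ⊂ S (j + 1)
  α_zero : α 0 = 0
  α_nonneg : ∀ j ≤ l, 0 ≤ α j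
  α_lt : ∀ j, 1 ≤ j → j < l → α j < α (j + 1)
  largest : ∀ j ≤ l, ∀ t : ℝ, α j ≤ t → (j < l → t < α (j + 1)) →
    IsLargestMinimizer (shifted ν b t) (S j) ∧
      ∀ A, IsLargestMinimizer (shifted ν b t) A → A = S j

/-!
Write `ν` for the dual of `μ`; it is monotone and submodular with `ν ∅ = 0` and `ν Ω = 1`, and put
`f_t(A) = ν(A) - t|A|`. Submodularity makes the minimizers of `f_t` increase with `t`
(`IsMinimizer.subset_of_le`): a minimizer at `s` is contained in every largest minimizer at `t ≥ s`.

Let `S ⊂ S'` be largest minimizers at some parameters, and let `α` be the density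
`(ν(S') - ν(S)) / |S' \ S|`, so that `f_α(S) = f_α(S')`. The density lies between the two
parameters, so the largest minimizer `S''` at `α` satisfies `S ⊆ S'' ⊆ S'`; it differs from `S`
because `S'` has the same value and more elements. If `S'' = S'`, then `S` is a minimizer at `α` too,
and `α` is the breakpoint at which the largest minimizer jumps from `S` to `S'` (`IsJump`).
Otherwise the recursion splits `S' \ S` into two nonempty parts. Hence a run on `(S, S')` makes at
most `2|S' \ S| - 1` calls and returns a chain whose consecutive members are jumps
(`exists_decomposition_eq`). A set which is a minimizer at two parameters is a minimizer between
them, and this gives the intervals on which each member of the chain is the largest minimizer.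

The vector `p` that equals the `j`-th density on `S_j \ S_{j-1}` satisfies `p(A) ≤ ν(A)`, by
induction along the chain of sets `A ∩ S_j`, with equality for `A = S_j`; so it is in the credal set.
For `q` in the credal set, `q(S_j) ≤ ν(S_j) = p(S_j)`. As `log p` increases along the chain,
summation by parts yields `-∑ q log p ≤ -∑ p log p` (`sum_sub_mul_log_nonpos`), and Gibbs'
inequality bounds `H(q)` by the left-hand side, strictly when `q ≠ p`.
-/

/-! ### Minimizers of the shifted functions -/

section Minimizers

variable {n : ℕ} {ν : Finset (Fin n) → ℝ} {s t : ℝ} {A B : Finset (Fin n)}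

theorem shifted_one_apply (ν : Finset (Fin n) → ℝ) (t : ℝ) (A : Finset (Fin n)) :
    shifted ν (fun _ => 1) t A = ν A - t * A.card := by
  simp [shifted]

theorem IsSubmodular.shifted (hν : IsSubmodular ν) (b : Fin n → ℝ) (t : ℝ) :
    IsSubmodular (shifted ν b t) := by
  refine ⟨by simp [_root_.shifted, hν.1], fun A B => ?_⟩
  have h1 := hν.2 A B
  have h2 := Finset.sum_union_inter (s₁ := A) (s₂ := B) (f := b)
  have h3 : t * ∑ i ∈ A ∪ B, b i + t * ∑ i ∈ A ∩ B, b i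
      = t * ∑ i ∈ A, b i + t * ∑ i ∈ B, b i := by
    rw [← mul_add, h2, mul_add]
  simp only [_root_.shifted]
  linarith

theorem isMinimizer_shifted_one :
    IsMinimizer (shifted ν (fun _ => 1) t) A ↔ ∀ B, ν A - t * A.card ≤ ν B - t * B.card := by
  simp only [IsMinimizer, shifted_one_apply]

/-- Minimizers increase with the parameter. For `s = t` this says that a largest minimizer contains
every minimizer. -/
theorem IsMinimizer.subset_of_le (hν : IsSubmodular ν)
    (hA : IsMinimizer (shifted ν (fun _ => 1) s) A)
    (hB : IsLargestMinimizer (shifted ν (fun _ => 1) t) B) (hst : s ≤ t) : A ⊆ B := by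
  have h1 := isMinimizer_shifted_one.1 hA (A ∩ B)
  have h2 := isMinimizer_shifted_one.1 hB.1
  have h3 := hν.2 A B
  have hcard : ((A ∪ B).card : ℝ) + (A ∩ B).card = A.card + B.card := by
    exact_mod_cast Finset.card_union_add_card_inter A B
  have hle : ((A ∩ B).card : ℝ) ≤ A.card := by
    exact_mod_cast Finset.card_le_card Finset.inter_subset_left
  have h4 : s * ((A.card : ℝ) - (A ∩ B).card) ≤ t * ((A.card : ℝ) - (A ∩ B).card) :=
    mul_le_mul_of_nonneg_right hst (by linarith)
  have hU : IsMinimizer (shifted ν (fun _ => 1) t) (A ∪ B) := by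
    refine isMinimizer_shifted_one.2 fun C => ?_
    have h5 : ((A ∪ B).card : ℝ) = A.card + B.card - (A ∩ B).card := by linarith
    have h6 := h2 C
    rw [h5]
    linarith
  have h7 : A ∪ B = B :=
    (Finset.eq_of_subset_of_card_le Finset.subset_union_right (hB.2 _ hU)).symm
  exact Finset.union_eq_right.1 h7

/-- A set that is a minimizer at `s` and at some later parameter `r` is the largest minimizer at
every parameter in `[s, r)`: a larger set that ties before `r` is strictly better at `r`. -/
theorem IsMinimizer.isLargestMinimizer_of_lt {r : ℝ}
    (hs : IsMinimizer (shifted ν (fun _ => 1) s) A)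
    (hr : IsMinimizer (shifted ν (fun _ => 1) r) A) (hst : s ≤ t) (htr : t < r) :
    IsLargestMinimizer (shifted ν (fun _ => 1) t) A := by
  rw [isMinimizer_shifted_one] at hs hr
  constructor
  · refine isMinimizer_shifted_one.2 fun B => ?_
    have h1 := hs B
    have h2 := hr B
    rcases le_total (A.card : ℝ) B.card with h | h <;> nlinarith
  · intro B hB
    have h1 := isMinimizer_shifted_one.1 hB A
    have h2 := hr B
    by_contra! hlt
    have hlt' : (A.card : ℝ) < B.card := by exact_mod_cast hlt
    nlinarith

theorem IsMinimizer.isLargestMinimizer_univ (hs : IsMinimizer (shifted ν (fun _ => 1) s) univ)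
    (hst : s ≤ t) : IsLargestMinimizer (shifted ν (fun _ => 1) t) univ := by
  rw [isMinimizer_shifted_one] at hs
  refine ⟨isMinimizer_shifted_one.2 fun B => ?_, fun B _ => Finset.card_le_univ B⟩
  have h1 := hs B
  have h2 : (B.card : ℝ) ≤ (univ : Finset (Fin n)).card := by
    exact_mod_cast Finset.card_le_univ B
  nlinarith

theorem IsLargestMinimizer.eq (hν : IsSubmodular ν)
    (hA : IsLargestMinimizer (shifted ν (fun _ => 1) t) A)
    (hB : IsLargestMinimizer (shifted ν (fun _ => 1) t) B) : A = B :=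
  (hA.1.subset_of_le hν hB le_rfl).antisymm (hB.1.subset_of_le hν hA le_rfl)

end Minimizers

/-! ### Densities and jumps of the largest minimizer -/

section Jumps

variable {n : ℕ} {ν : Finset (Fin n) → ℝ} {s t : ℝ} {A B : Finset (Fin n)}

/-- The average increment of `ν` per element of `B \ A`. It is used for `A ⊂ B`, where it is the
parameter at which `A` and `B` have the same shifted value. -/
noncomputable def density (ν : Finset (Fin n) → ℝ) (A B : Finset (Fin n)) : ℝ :=
  (ν B - ν A) / ((B \ A).card : ℝ)

theorem density_mul_card_sdiff (ν : Finset (Fin n) → ℝ) (h : A ⊂ B) :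
    density ν A B * ((B \ A).card : ℝ) = ν B - ν A := by
  have : ((B \ A).card : ℝ) ≠ 0 := by
    have := Finset.card_pos.2 (Finset.sdiff_nonempty.2 h.2)
    positivity
  exact div_mul_cancel₀ _ this

theorem cast_card_sdiff_of_subset (h : A ⊆ B) :
    ((B \ A).card : ℝ) = (B.card : ℝ) - A.card := by
  rw [Finset.card_sdiff_of_subset h, Nat.cast_sub (Finset.card_le_card h)]

theorem shifted_density_eq (ν : Finset (Fin n) → ℝ) (h : A ⊂ B) :
    shifted ν (fun _ => 1) (density ν A B) A = shifted ν (fun _ => 1) (density ν A B) B := by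
  have h1 := density_mul_card_sdiff ν h
  rw [cast_card_sdiff_of_subset h.1] at h1
  rw [shifted_one_apply, shifted_one_apply]
  linarith

theorem IsLargestMinimizer.lt_density (hA : IsLargestMinimizer (shifted ν (fun _ => 1) s) A)
    (h : A ⊂ B) : s < density ν A B := by
  have hpos : (A.card : ℝ) < B.card := by exact_mod_cast Finset.card_lt_card h
  have h1 := density_mul_card_sdiff ν h
  rw [cast_card_sdiff_of_subset h.1] at h1
  have hB : ¬ IsMinimizer (shifted ν (fun _ => 1) s) B := fun hB =>
    (Finset.card_lt_card h).not_ge (hA.2 B hB)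
  by_contra! hle
  refine hB (isMinimizer_shifted_one.2 fun C => ?_)
  have h2 := isMinimizer_shifted_one.1 hA.1 C
  nlinarith

theorem IsMinimizer.density_le (hB : IsMinimizer (shifted ν (fun _ => 1) t) B) (h : A ⊂ B) :
    density ν A B ≤ t := by
  have hpos : (A.card : ℝ) < B.card := by exact_mod_cast Finset.card_lt_card h
  have h1 := density_mul_card_sdiff ν h
  rw [cast_card_sdiff_of_subset h.1] at h1
  have h2 := isMinimizer_shifted_one.1 hB A
  by_contra! hlt
  nlinarith

/-- The largest minimizer jumps from `A` to `B`: at the parameter where the two sets have the same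
value, both are minimizers and `B` is a largest one. -/
structure IsJump (ν : Finset (Fin n) → ℝ) (A B : Finset (Fin n)) : Prop where
  ssubset : A ⊂ B
  left : IsMinimizer (shifted ν (fun _ => 1) (density ν A B)) A
  right : IsLargestMinimizer (shifted ν (fun _ => 1) (density ν A B)) B

theorem IsJump.density_lt {C : Finset (Fin n)} (h : IsJump ν A B) (h' : IsJump ν B C) :
    density ν A B < density ν B C :=
  h.right.lt_density h'.ssubset

end Jumps

/-! ### The decomposition algorithm -/

section Algorithm

variable {n : ℕ} {ν : Finset (Fin n) → ℝ}

/-- A chain `S 0 ⊂ ⋯ ⊂ S l` from `A` to `B` whose consecutive members are jumps. Only the values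
`S j` with `j ≤ l` matter. -/
structure IsJumpChain (ν : Finset (Fin n) → ℝ) (A B : Finset (Fin n)) (l : ℕ)
    (S : ℕ → Finset (Fin n)) : Prop where
  zero : S 0 = A
  last : S l = B
  jump : ∀ j < l, IsJump ν (S j) (S (j + 1))

theorem IsJump.exists_chain {A B : Finset (Fin n)} (h : IsJump ν A B) :
    ∃ (l : ℕ) (S : ℕ → Finset (Fin n)), IsJumpChain ν A B l S ∧
      ({A, B} : Finset (Finset (Fin n))) = (Finset.range (l + 1)).image S := by
  refine ⟨1, fun j => if j = 0 then A else B, ⟨rfl, rfl, fun j hj => ?_⟩, ?_⟩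
  · obtain rfl : j = 0 := by omega
    simpa using h
  · ext D
    simp [Finset.range_add_one, or_comm]

theorem IsJumpChain.exists_append {A B C : Finset (Fin n)} {l m : ℕ} {S T : ℕ → Finset (Fin n)}
    (hS : IsJumpChain ν A B l S) (hT : IsJumpChain ν B C m T) :
    ∃ U : ℕ → Finset (Fin n), IsJumpChain ν A C (l + m) U ∧
      (Finset.range (l + 1)).image S ∪ (Finset.range (m + 1)).image T =
        (Finset.range (l + m + 1)).image U := by
  set U : ℕ → Finset (Fin n) := fun j => if j ≤ l then S j else T (j - l) with hU
  have hUS : ∀ j ≤ l, U j = S j := fun j hj => if_pos hj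
  have hUT : ∀ j, U (l + j) = T j := by
    intro j
    rcases Nat.eq_zero_or_pos j with rfl | hj
    · rw [add_zero, hUS l le_rfl, hS.last, hT.zero]
    · simp only [hU]
      rw [if_neg (by omega), Nat.add_sub_cancel_left]
  refine ⟨U, ⟨by rw [hUS 0 (Nat.zero_le _), hS.zero], by rw [hUT, hT.last], fun j hj => ?_⟩, ?_⟩
  · rcases lt_or_ge j l with h | h
    · rw [hUS j h.le, hUS (j + 1) h]
      exact hS.jump j h
    · obtain ⟨i, rfl⟩ := Nat.exists_eq_add_of_le h
      rw [hUT, add_assoc, hUT]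
      exact hT.jump i (by omega)
  · ext D
    simp only [Finset.mem_union, Finset.mem_image, Finset.mem_range]
    constructor
    · rintro (⟨j, hj, rfl⟩ | ⟨j, hj, rfl⟩)
      · exact ⟨j, by omega, hUS j (by omega)⟩
      · exact ⟨l + j, by omega, hUT j⟩
    · rintro ⟨j, hj, rfl⟩
      rcases le_total j l with h | h
      · exact Or.inl ⟨j, by omega, (hUS j h).symm⟩
      · obtain ⟨i, rfl⟩ := Nat.exists_eq_add_of_le h
        exact Or.inr ⟨i, by omega, (hUT i).symm⟩

/-- Correctness and cost of a run between two largest minimizers: recursion depth `|S' \ S|` is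
enough, and the run makes at most `2|S' \ S| - 1` oracle calls. -/
theorem exists_decomposition_eq (hν : IsSubmodular ν)
    {O : (Finset (Fin n) → ℝ) → Finset (Fin n)} (hO : IsSFMOracle O) (k : ℕ) :
    ∀ (S S' : Finset (Fin n)) (s t : ℝ), S ⊂ S' →
      IsLargestMinimizer (shifted ν (fun _ => 1) s) S →
      IsLargestMinimizer (shifted ν (fun _ => 1) t) S' → (S' \ S).card ≤ k →
      ∃ (chain : Finset (Finset (Fin n))) (calls : List (Finset (Fin n) → ℝ)),
        decomposition O ν (fun _ => 1) k S S' = some (chain, calls) ∧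
        (∀ f ∈ calls, IsSubmodular f) ∧ calls.length + 1 ≤ 2 * (S' \ S).card ∧
        ∃ (l : ℕ) (T : ℕ → Finset (Fin n)), IsJumpChain ν S S' l T ∧
          chain = (Finset.range (l + 1)).image T := by
  induction k with
  | zero =>
    intro S S' s t hSS' _ _ hk
    have := Finset.card_pos.2 (Finset.sdiff_nonempty.2 hSS'.2)
    omega
  | succ k ih =>
    intro S S' s t hSS' hS hS' hk
    have hα : (ν S' - ν S) / ∑ i ∈ S' \ S, (1 : ℝ) = density ν S S' := by simp [density]
    set f := shifted ν (fun _ => 1) (density ν S S') with hf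
    have hsub : IsSubmodular f := hν.shifted _ _
    have hmin : IsLargestMinimizer f (O f) := hO f hsub
    have heq : f S = f S' := shifted_density_eq ν hSS'
    have hpos := Finset.card_pos.2 (Finset.sdiff_nonempty.2 hSS'.2)
    by_cases hOS : O f = S'
    · rw [hOS] at hmin
      have hjump : IsJump ν S S' := ⟨hSS', fun B => heq.trans_le (hmin.1 B), hmin⟩
      refine ⟨{S, S'}, [f], ?_, by simpa using hsub, by rw [List.length_singleton]; omega, hjump.exists_chain⟩
      simp only [decomposition, hα, ← hf, hOS, if_true]
    · have hne : S ≠ O f := by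
        intro h
        rw [← h] at hmin
        exact (Finset.card_lt_card hSS').not_ge (hmin.2 S' fun B => heq ▸ hmin.1 B)
      have h1 : S ⊂ O f :=
        (hS.1.subset_of_le hν hmin (hS.lt_density hSS').le).ssubset_of_ne hne
      have h2 : O f ⊂ S' :=
        (hmin.1.subset_of_le hν hS' (hS'.1.density_le hSS')).ssubset_of_ne hOS
      have hc1 := Finset.card_sdiff_of_subset h1.1
      have hc2 := Finset.card_sdiff_of_subset h2.1
      have hc3 := Finset.card_sdiff_of_subset hSS'.1
      have hlt1 := Finset.card_lt_card h1
      have hlt2 := Finset.card_lt_card h2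
      obtain ⟨c, r, hr, hrs, hrl, l, T, hT, rfl⟩ :=
        ih S (O f) s (density ν S S') h1 hS hmin (by omega)
      obtain ⟨c', r', hr', hrs', hrl', m, T', hT', rfl⟩ :=
        ih (O f) S' (density ν S S') t h2 hmin hS' (by omega)
      obtain ⟨U, hU, hUe⟩ := hT.exists_append hT'
      refine ⟨_, f :: (r ++ r'), ?_, ?_, ?_, l + m, U, hU, hUe⟩
      · simp only [decomposition, hα, ← hf, if_neg hOS, hr, hr', Option.bind_some]
      · intro g hg
        rcases List.mem_cons.1 hg with rfl | hg
        · exact hsub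
        · exact (List.mem_append.1 hg).elim (hrs g) (hrs' g)
      · simp only [List.length_cons, List.length_append]
        omega

end Algorithm

/-! ### Breakpoints of a chain of jumps -/

section Breakpoints

variable {n : ℕ} {ν : Finset (Fin n) → ℝ} {l : ℕ} {S : ℕ → Finset (Fin n)}

/-- The breakpoints of a chain: `0`, followed by the densities of its consecutive members. -/
noncomputable def breakpoint (ν : Finset (Fin n) → ℝ) (S : ℕ → Finset (Fin n)) : ℕ → ℝ
  | 0 => 0
  | j + 1 => density ν (S j) (S (j + 1))

theorem IsJumpChain.subset {A B : Finset (Fin n)} (h : IsJumpChain ν A B l S) {i j : ℕ}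
    (hij : i ≤ j) (hj : j ≤ l) : S i ⊆ S j := by
  induction j, hij using Nat.le_induction with
  | base => exact subset_rfl
  | succ j _ ih => exact (ih (by omega)).trans (h.jump j (by omega)).ssubset.1

theorem IsJumpChain.breakpoint_lt {A B : Finset (Fin n)} (h : IsJumpChain ν A B l S) {j : ℕ}
    (h1 : 1 ≤ j) (hj : j < l) : breakpoint ν S j < breakpoint ν S (j + 1) := by
  obtain ⟨i, rfl⟩ : ∃ i, j = i + 1 := ⟨j - 1, by omega⟩
  exact (h.jump i (by omega)).density_lt (h.jump (i + 1) hj)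

theorem density_nonneg (hmono : ∀ A B, A ⊆ B → ν A ≤ ν B) {A B : Finset (Fin n)} (h : A ⊆ B) :
    0 ≤ density ν A B :=
  div_nonneg (sub_nonneg.2 (hmono _ _ h)) (Nat.cast_nonneg _)

theorem IsJumpChain.breakpoint_nonneg {A B : Finset (Fin n)} (h : IsJumpChain ν A B l S)
    (hmono : ∀ A B, A ⊆ B → ν A ≤ ν B) {j : ℕ} (hj : j ≤ l) : 0 ≤ breakpoint ν S j := by
  cases j with
  | zero => exact le_rfl
  | succ j => exact density_nonneg hmono (h.jump j (by omega)).ssubset.1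

theorem IsJumpChain.breakpoint_mono {A B : Finset (Fin n)} (h : IsJumpChain ν A B l S)
    (hmono : ∀ A B, A ⊆ B → ν A ≤ ν B) {i j : ℕ} (hij : i ≤ j) (hj : j ≤ l) :
    breakpoint ν S i ≤ breakpoint ν S j := by
  induction j, hij using Nat.le_induction with
  | base => exact le_rfl
  | succ j _ ih =>
    refine (ih (by omega)).trans ?_
    rcases Nat.eq_zero_or_pos j with rfl | h1
    · exact h.breakpoint_nonneg hmono hj
    · exact (h.breakpoint_lt h1 (by omega)).le

theorem IsJumpChain.isDecompositionChain (hν : IsSubmodular ν)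
    (hmono : ∀ A B, A ⊆ B → ν A ≤ ν B) (hne : (univ : Finset (Fin n)).Nonempty)
    (h : IsJumpChain ν ∅ univ l S) :
    IsDecompositionChain ν (fun _ => 1) l S (breakpoint ν S) := by
  have hl : l ≠ 0 := by
    rintro rfl
    exact hne.ne_empty (h.last.symm.trans h.zero)
  -- The lower end of the interval of `S j`; for `j = 0` this uses that `ν` is nonnegative.
  have hmin : ∀ j ≤ l, IsMinimizer (shifted ν (fun _ => 1) (breakpoint ν S j)) (S j) := by
    intro j hj
    cases j with
    | zero =>
      refine isMinimizer_shifted_one.2 fun B => ?_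
      simpa [breakpoint, h.zero] using hmono _ _ (Finset.empty_subset B)
    | succ j => exact (h.jump j (by omega)).right.1
  refine ⟨h.zero, h.last, fun j hj => (h.jump j hj).ssubset, rfl,
    fun j hj => h.breakpoint_nonneg hmono hj, fun j h1 hj => h.breakpoint_lt h1 hj,
    fun j hj t hjt htj => ?_⟩
  have hlarge : IsLargestMinimizer (shifted ν (fun _ => 1) t) (S j) := by
    rcases hj.lt_or_eq with hj' | rfl
    · exact (hmin j hj).isLargestMinimizer_of_lt (h.jump j hj').left hjt (htj hj')
    · have := hmin j hj
      rw [h.last] at this ⊢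
      exact this.isLargestMinimizer_univ hjt
  exact ⟨hlarge, fun A hA => hA.eq hν hlarge⟩

end Breakpoints

/-! ### The vector of densities and its entropy -/

section Density

variable {n : ℕ} {ν : Finset (Fin n) → ℝ} {l : ℕ} {S : ℕ → Finset (Fin n)} {p : Fin n → ℝ}

theorem IsJumpChain.exists_density_vector (h : IsJumpChain ν ∅ univ l S) :
    ∃ p : Fin n → ℝ, ∀ j < l, ∀ i ∈ S (j + 1) \ S j, p i = breakpoint ν S (j + 1) := by
  classical
  have hex : ∀ i, ∃ j, i ∈ S j := fun i => ⟨l, h.last ▸ Finset.mem_univ i⟩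
  refine ⟨fun i => breakpoint ν S (Nat.find (hex i)), fun j hj i hi => ?_⟩
  rw [Finset.mem_sdiff] at hi
  have : Nat.find (hex i) = j + 1 := by
    rw [Nat.find_eq_iff]
    exact ⟨hi.1, fun m hm him => hi.2 (h.subset (by omega) hj.le him)⟩
  simp only [this]

theorem IsJumpChain.exists_mem_sdiff {B : Finset (Fin n)} (h : IsJumpChain ν ∅ B l S) {k : ℕ}
    {i : Fin n} (hi : i ∈ S k) : ∃ j < k, i ∈ S (j + 1) \ S j := by
  induction k with
  | zero => simp [h.zero] at hi
  | succ k ih =>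
    by_cases hik : i ∈ S k
    · obtain ⟨j, hj, hij⟩ := ih hik
      exact ⟨j, by omega, hij⟩
    · exact ⟨k, by omega, Finset.mem_sdiff.2 ⟨hi, hik⟩⟩

theorem IsJumpChain.sum_succ {A B : Finset (Fin n)} (h : IsJumpChain ν A B l S) {j : ℕ}
    (hj : j < l) (g : Fin n → ℝ) :
    ∑ i ∈ S (j + 1), g i = ∑ i ∈ S j, g i + ∑ i ∈ S (j + 1) \ S j, g i := by
  rw [← Finset.sum_sdiff (h.jump j hj).ssubset.1, add_comm]

theorem IsJumpChain.sum_eq (h : IsJumpChain ν ∅ univ l S) (h0 : ν ∅ = 0)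
    (hp : ∀ j < l, ∀ i ∈ S (j + 1) \ S j, p i = breakpoint ν S (j + 1)) {j : ℕ} (hj : j ≤ l) :
    ∑ i ∈ S j, p i = ν (S j) := by
  induction j with
  | zero => simp [h.zero, h0]
  | succ j ih =>
    rw [h.sum_succ hj, ih (by omega), Finset.sum_congr rfl (hp j hj), Finset.sum_const,
      nsmul_eq_mul, mul_comm]
    simp only [breakpoint]
    rw [density_mul_card_sdiff ν (h.jump j hj).ssubset]
    ring

/-- The vector of densities is dominated by `ν`. At each jump, submodularity compares the increment
of `ν` along `A ∩ S j ⊆ A ∩ S (j + 1)` with the one along `S j ⊆ (A ∩ S (j + 1)) ∪ S j`, and `S j`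
being a minimizer at the breakpoint bounds the latter. -/
theorem IsJumpChain.sum_le (hν : IsSubmodular ν) (h : IsJumpChain ν ∅ univ l S)
    (hp : ∀ j < l, ∀ i ∈ S (j + 1) \ S j, p i = breakpoint ν S (j + 1)) (A : Finset (Fin n)) :
    ∑ i ∈ A, p i ≤ ν A := by
  have key : ∀ j ≤ l, ∑ i ∈ A ∩ S j, p i ≤ ν (A ∩ S j) := by
    intro j
    induction j with
    | zero => intro _; simp [h.zero, hν.1]
    | succ j ih =>
      intro hj
      have hss := (h.jump j hj).ssubset.1
      have hinter : (A ∩ S (j + 1)) ∩ S j = A ∩ S j := by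
        rw [Finset.inter_assoc, Finset.inter_eq_right.2 hss]
      have hsub : A ∩ S j ⊆ A ∩ S (j + 1) := Finset.inter_subset_inter_left hss
      have hmem : ∀ i ∈ (A ∩ S (j + 1)) \ (A ∩ S j), p i = breakpoint ν S (j + 1) := by
        intro i hi
        refine hp j hj i ?_
        simp only [Finset.mem_sdiff, Finset.mem_inter] at hi ⊢
        tauto
      have hsum : ∑ i ∈ A ∩ S (j + 1), p i = ∑ i ∈ A ∩ S j, p i
          + breakpoint ν S (j + 1) * (((A ∩ S (j + 1)).card : ℝ) - (A ∩ S j).card) := by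
        rw [← Finset.sum_sdiff hsub, Finset.sum_congr rfl hmem, Finset.sum_const, nsmul_eq_mul,
          cast_card_sdiff_of_subset hsub]
        ring
      have h1 := hν.2 (A ∩ S (j + 1)) (S j)
      rw [hinter] at h1
      have h2 : (((A ∩ S (j + 1)) ∪ S j).card : ℝ) + (A ∩ S j).card
          = (A ∩ S (j + 1)).card + (S j).card := by
        have := Finset.card_union_add_card_inter (A ∩ S (j + 1)) (S j)
        rw [hinter] at this
        exact_mod_cast this
      have h3 : ν (S j) - breakpoint ν S (j + 1) * (S j).card
          ≤ ν (A ∩ S (j + 1) ∪ S j) - breakpoint ν S (j + 1) * (A ∩ S (j + 1) ∪ S j).card :=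
        isMinimizer_shifted_one.1 (h.jump j hj).left (A ∩ S (j + 1) ∪ S j)
      have h4 : ((A ∩ S (j + 1) ∪ S j).card : ℝ)
          = (A ∩ S (j + 1)).card + (S j).card - (A ∩ S j).card := by linarith
      rw [h4] at h3
      have h5 := ih (by omega)
      rw [hsum]
      linarith
  simpa [h.last] using key l le_rfl

theorem IsJumpChain.le_breakpoint {B : Finset (Fin n)} (h : IsJumpChain ν ∅ B l S)
    (hmono : ∀ A B, A ⊆ B → ν A ≤ ν B)
    (hp : ∀ j < l, ∀ i ∈ S (j + 1) \ S j, p i = breakpoint ν S (j + 1)) {k : ℕ} (hk : k ≤ l)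
    {i : Fin n} (hi : i ∈ S k) : p i ≤ breakpoint ν S k := by
  obtain ⟨j, hj, hij⟩ := h.exists_mem_sdiff hi
  rw [hp j (by omega) i hij]
  exact h.breakpoint_mono hmono hj hk

theorem IsJumpChain.nonneg (h : IsJumpChain ν ∅ univ l S)
    (hmono : ∀ A B, A ⊆ B → ν A ≤ ν B)
    (hp : ∀ j < l, ∀ i ∈ S (j + 1) \ S j, p i = breakpoint ν S (j + 1)) (i : Fin n) :
    0 ≤ p i := by
  obtain ⟨j, hj, hij⟩ := h.exists_mem_sdiff (k := l) (h.last ▸ Finset.mem_univ i)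
  rw [hp j hj i hij]
  exact h.breakpoint_nonneg hmono hj

/-- The density vector `p` carries the most mass on each `S j`, where `log p` is small; hence moving
from `q` to `p` does not increase the mean of `log p`. -/
theorem IsJumpChain.sum_sub_mul_log_nonpos (h : IsJumpChain ν ∅ univ l S) (h0 : ν ∅ = 0)
    (hmono : ∀ A B, A ⊆ B → ν A ≤ ν B)
    (hp : ∀ j < l, ∀ i ∈ S (j + 1) \ S j, p i = breakpoint ν S (j + 1))
    {q : Fin n → ℝ} (hq0 : ∀ i, 0 ≤ q i) (hq : ∀ A, ∑ i ∈ A, q i ≤ ν A)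
    (hq1 : ∑ i, q i = ν univ) : ∑ i, (p i - q i) * Real.log (p i) ≤ 0 := by
  -- Summation by parts, in the form of an induction along the chain.
  have key : ∀ k ≤ l, ∑ i ∈ S k, (p i - q i) * Real.log (p i)
      ≤ (∑ i ∈ S k, (p i - q i)) * Real.log (breakpoint ν S k) := by
    intro k
    induction k with
    | zero => intro _; simp [h.zero]
    | succ k ih =>
      intro hk
      set D := ∑ i ∈ S k, (p i - q i) with hD
      have hD0 : 0 ≤ D := by
        rw [hD, Finset.sum_sub_distrib, h.sum_eq h0 hp (by omega : k ≤ l), sub_nonneg]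
        exact hq _
      have hDlog : D * Real.log (breakpoint ν S k) ≤ D * Real.log (breakpoint ν S (k + 1)) := by
        rcases hD0.eq_or_lt with hD' | hD'
        · simp [← hD']
        · -- `D > 0` forces a positive breakpoint, so the value of `Real.log` at `0` is not used.
          have hex : ∃ i ∈ S k, 0 < p i - q i := by
            by_contra! hcon
            exact hD'.not_ge (Finset.sum_nonpos hcon)
          obtain ⟨i, hi, hpi⟩ := hex
          have hpos : 0 < breakpoint ν S k :=
            (lt_of_lt_of_le (by linarith [hq0 i]) (h.le_breakpoint hmono hp (by omega) hi))
          exact mul_le_mul_of_nonneg_left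
            (Real.log_le_log hpos (h.breakpoint_mono hmono k.le_succ hk)) hD0
      have hlast : ∑ i ∈ S (k + 1) \ S k, (p i - q i) * Real.log (p i)
          = (∑ i ∈ S (k + 1) \ S k, (p i - q i)) * Real.log (breakpoint ν S (k + 1)) := by
        rw [Finset.sum_mul]
        exact Finset.sum_congr rfl fun i hi => by rw [hp k hk i hi]
      rw [h.sum_succ hk, h.sum_succ hk, hlast, add_mul]
      have := ih (by omega)
      linarith
  have hl := key l le_rfl
  have hsum := h.sum_eq h0 hp le_rfl
  rw [h.last] at hl hsum
  have hzero : ∑ i, (p i - q i) = 0 := by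
    rw [Finset.sum_sub_distrib, hsum, hq1, sub_self]
  rwa [hzero, zero_mul] at hl

theorem mul_log_sub_mul_log_le {x y : ℝ} (hx : 0 ≤ x) (hy : 0 ≤ y) (h : x = 0 → y = 0) :
    y * Real.log x - y * Real.log y ≤ x - y ∧
      (y ≠ x → y * Real.log x - y * Real.log y < x - y) := by
  rcases hy.eq_or_lt with rfl | hy
  · exact ⟨by simpa using hx, fun hne => by simpa using lt_of_le_of_ne hx hne⟩
  have hx : 0 < x := lt_of_le_of_ne hx fun h' => hy.ne' (h h'.symm)
  have hlog : y * Real.log x - y * Real.log y = y * Real.log (x / y) := by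
    rw [Real.log_div hx.ne' hy.ne']
    ring
  have hxy : x - y = y * (x / y - 1) := by
    field_simp
  rw [hlog, hxy]
  refine ⟨mul_le_mul_of_nonneg_left (Real.log_le_sub_one_of_pos (div_pos hx hy)) hy.le,
    fun hne => mul_lt_mul_of_pos_left (Real.log_lt_sub_one_of_pos (div_pos hx hy) ?_) hy⟩
  exact fun h1 => hne ((div_eq_one_iff_eq hy.ne').1 h1).symm

/-- Strict Gibbs inequality. -/
theorem shannonEntropy_lt_neg_sum_mul_log {p q : Fin n → ℝ} (hp : ∀ i, 0 ≤ p i)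
    (hq : ∀ i, 0 ≤ q i) (hpq : ∀ i, p i = 0 → q i = 0) (hsum : ∑ i, p i = ∑ i, q i)
    (hne : q ≠ p) : shannonEntropy q < -∑ i, q i * Real.log (p i) := by
  obtain ⟨i, hi⟩ := Function.ne_iff.1 hne
  have hlt : ∑ i, (q i * Real.log (p i) - q i * Real.log (q i)) < ∑ i, (p i - q i) :=
    Finset.sum_lt_sum (fun i _ => (mul_log_sub_mul_log_le (hp i) (hq i) (hpq i)).1)
      ⟨i, Finset.mem_univ i, (mul_log_sub_mul_log_le (hp i) (hq i) (hpq i)).2 hi⟩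
  rw [Finset.sum_sub_distrib, Finset.sum_sub_distrib, hsum, sub_self] at hlt
  simp only [shannonEntropy]
  linarith

theorem IsJumpChain.shannonEntropy_lt (h : IsJumpChain ν ∅ univ l S) (h0 : ν ∅ = 0)
    (hmono : ∀ A B, A ⊆ B → ν A ≤ ν B)
    (hp : ∀ j < l, ∀ i ∈ S (j + 1) \ S j, p i = breakpoint ν S (j + 1))
    {q : Fin n → ℝ} (hq0 : ∀ i, 0 ≤ q i) (hq : ∀ A, ∑ i ∈ A, q i ≤ ν A)
    (hq1 : ∑ i, q i = ν univ) (hne : q ≠ p) : shannonEntropy q < shannonEntropy p := by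
  have hsum := h.sum_eq h0 hp le_rfl
  rw [h.last] at hsum
  have hpq : ∀ i, p i = 0 → q i = 0 := by
    intro i hi
    obtain ⟨j, hj, hij⟩ := h.exists_mem_sdiff (k := l) (h.last ▸ Finset.mem_univ i)
    -- The breakpoint of the block of `i` is `0`, so `p` vanishes on `S (j + 1)` and thus `ν` does.
    have hα : breakpoint ν S (j + 1) = 0 := by rw [← hp j hj i hij, hi]
    have hS : ν (S (j + 1)) ≤ 0 := by
      rw [← h.sum_eq h0 hp hj]
      exact Finset.sum_nonpos fun i' hi' => hα ▸ h.le_breakpoint hmono hp hj hi'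
    have h1 : q i ≤ ∑ i' ∈ S (j + 1), q i' :=
      Finset.single_le_sum (fun i' _ => hq0 i') (Finset.mem_sdiff.1 hij).1
    exact le_antisymm ((h1.trans (hq _)).trans hS) (hq0 i)
  have hgibbs := shannonEntropy_lt_neg_sum_mul_log (h.nonneg hmono hp) hq0 hpq
    (hsum.trans hq1.symm) hne
  have habel := h.sum_sub_mul_log_nonpos h0 hmono hp hq0 hq hq1
  simp only [sub_mul] at habel
  rw [Finset.sum_sub_distrib] at habel
  refine hgibbs.trans_le ?_
  simp only [shannonEntropy]
  linarith

end Density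

/-! ### The dual of a 2-monotone lower probability -/

section Dual

variable {n : ℕ} {μ : Finset (Fin n) → ℝ}

theorem IsTwoMonotone.isSubmodular_dualProb (hμ : IsTwoMonotone μ) :
    IsSubmodular (dualProb μ) := by
  refine ⟨by simp [dualProb, hμ.isLowerProbability.map_univ], fun A B => ?_⟩
  have h := hμ.isSupermodular.2 Aᶜ Bᶜ
  simp only [dualProb, Finset.compl_union, Finset.compl_inter]
  linarith

theorem IsLowerProbability.dualProb_mono (hμ : IsLowerProbability μ) (A B : Finset (Fin n))
    (h : A ⊆ B) : dualProb μ A ≤ dualProb μ B := by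
  have := hμ.mono _ _ (Finset.compl_subset_compl.2 h)
  simp only [dualProb]
  linarith

theorem IsLowerProbability.dualProb_univ (hμ : IsLowerProbability μ) : dualProb μ univ = 1 := by
  simp [dualProb, hμ.map_empty]

theorem mem_credalSet_iff_le_dualProb {p : Fin n → ℝ} :
    p ∈ credalSet μ ↔ (∀ i, 0 ≤ p i) ∧ ∑ i, p i = 1 ∧ ∀ A, ∑ i ∈ A, p i ≤ dualProb μ A := by
  refine ⟨fun h => ⟨h.1.1, h.1.2, fun A => ?_⟩, fun h => ⟨⟨h.1, h.2.1⟩, fun A => ?_⟩⟩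
  · have h1 := Finset.sum_add_sum_compl A p
    have h2 := h.2 Aᶜ
    have h3 := h.1.2
    simp only [dualProb]
    linarith
  · have h1 := Finset.sum_add_sum_compl A p
    have h2 := h.2.2 Aᶜ
    have h3 := h.2.1
    simp only [dualProb, compl_compl] at h2
    linarith

/-- Negative parameters make the empty set the only minimizer. -/
theorem isLargestMinimizer_empty {ν : Finset (Fin n) → ℝ} (h0 : ν ∅ = 0)
    (hmono : ∀ A B, A ⊆ B → ν A ≤ ν B) :
    IsLargestMinimizer (shifted ν (fun _ => 1) (-1)) ∅ := by
  have hpos : ∀ B, 0 ≤ ν B := fun B => h0 ▸ hmono _ _ (Finset.empty_subset B)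
  constructor
  · refine isMinimizer_shifted_one.2 fun B => ?_
    have := hpos B
    have : (0 : ℝ) ≤ B.card := Nat.cast_nonneg _
    simp only [h0, Finset.card_empty, Nat.cast_zero]
    linarith
  · intro B hB
    have h1 := isMinimizer_shifted_one.1 hB ∅
    have h2 := hpos B
    simp only [h0, Finset.card_empty, Nat.cast_zero] at h1
    have h3 : (B.card : ℝ) ≤ ((∅ : Finset (Fin n)).card : ℝ) := by
      simp only [Finset.card_empty, Nat.cast_zero]
      linarith
    exact_mod_cast h3

theorem isLargestMinimizer_univ_of_mono {ν : Finset (Fin n) → ℝ} (h0 : ν ∅ = 0)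
    (hmono : ∀ A B, A ⊆ B → ν A ≤ ν B) :
    IsLargestMinimizer (shifted ν (fun _ => 1) (ν univ)) univ := by
  have hpos : ∀ B, 0 ≤ ν B := fun B => h0 ▸ hmono _ _ (Finset.empty_subset B)
  refine ⟨isMinimizer_shifted_one.2 fun B => ?_, fun B _ => Finset.card_le_univ B⟩
  rcases eq_or_ne B univ with rfl | hB
  · exact le_rfl
  have h1 : (B.card : ℝ) + 1 ≤ (univ : Finset (Fin n)).card := by
    exact_mod_cast Finset.card_lt_card (Finset.ssubset_univ_iff.2 hB)
  have h2 := mul_le_mul_of_nonneg_left h1 (hpos univ)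
  have h3 := hpos B
  linarith

end Dual

theorem proposition2 :
    ∃ C : ℕ, ∀ (n : ℕ) (μ : Finset (Fin n) → ℝ), IsTwoMonotone μ →
      ∀ O : (Finset (Fin n) → ℝ) → Finset (Fin n), IsSFMOracle O →
        ∃ (depth : ℕ) (chain : Finset (Finset (Fin n)))
          (calls : List (Finset (Fin n) → ℝ)),
          -- the algorithm terminates on `(μ̄, 1)`, after `O(n)` submodular minimizations
          decomposition O (dualProb μ) (fun _ => 1) depth ∅ Finset.univ = some (chain, calls) ∧
          (∀ f ∈ calls, IsSubmodular f) ∧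
          calls.length ≤ C * n ∧
          -- its output is the chain of largest minimizers
          ∃ (l : ℕ) (S : ℕ → Finset (Fin n)) (α : ℕ → ℝ),
            IsDecompositionChain (dualProb μ) (fun _ => 1) l S α ∧
            ((∀ i, 0 < dualProb μ {i}) → 0 < α 1) ∧
            chain = (Finset.range (l + 1)).image S ∧
            -- the vector read off from the chain is the unique maximizer of the entropy
            ∃ p : Fin n → ℝ,
              (∀ j < l, ∀ i ∈ S (j + 1) \ S j,
                p i = (dualProb μ (S (j + 1)) - dualProb μ (S j)) /
                  ((S (j + 1) \ S j).card : ℝ)) ∧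
              p ∈ credalSet μ ∧
              (∀ q ∈ credalSet μ, q ≠ p → shannonEntropy q < shannonEntropy p) ∧
              upperEntropy μ = shannonEntropy p := by
  refine ⟨2, fun n μ hμ O hO => ?_⟩
  have hν := hμ.isSubmodular_dualProb
  have hmono := hμ.isLowerProbability.dualProb_mono
  have huniv := hμ.isLowerProbability.dualProb_univ
  -- `μ ∅ = 0 ≠ 1 = μ univ`, so the ground set is not empty.
  have hne : (univ : Finset (Fin n)).Nonempty := by
    refine Finset.nonempty_iff_ne_empty.2 fun h => ?_
    rw [h, hν.1] at huniv
    exact zero_ne_one huniv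
  obtain ⟨chain, calls, hrun, hsub, hlen, l, S, hS, rfl⟩ :=
    exists_decomposition_eq hν hO n ∅ univ _ _ (Finset.empty_ssubset.2 hne)
      (isLargestMinimizer_empty hν.1 hmono) (isLargestMinimizer_univ_of_mono hν.1 hmono)
      (by simp)
  obtain ⟨p, hp⟩ := hS.exists_density_vector
  have hl : 0 < l := by
    refine Nat.pos_of_ne_zero ?_
    rintro rfl
    exact hne.ne_empty (hS.last.symm.trans hS.zero)
  have hpmem : p ∈ credalSet μ := by
    refine mem_credalSet_iff_le_dualProb.2 ⟨hS.nonneg hmono hp, ?_, hS.sum_le hν hp⟩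
    have := hS.sum_eq hν.1 hp le_rfl
    rwa [hS.last, huniv] at this
  have hmax : ∀ q ∈ credalSet μ, q ≠ p → shannonEntropy q < shannonEntropy p := by
    intro q hq hqp
    obtain ⟨hq0, hq1, hqle⟩ := mem_credalSet_iff_le_dualProb.1 hq
    exact hS.shannonEntropy_lt hν.1 hmono hp hq0 hqle (hq1.trans huniv.symm) hqp
  refine ⟨n, _, calls, hrun, hsub, ?_, l, S, breakpoint (dualProb μ) S,
    hS.isDecompositionChain hν hmono hne, fun hpos => ?_, rfl, p, hp, hpmem, hmax, ?_⟩
  · simp only [Finset.sdiff_empty, Finset.card_univ, Fintype.card_fin] at hlen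
    omega
  · have hss := (hS.jump 0 hl).ssubset
    obtain ⟨i, hi⟩ := Finset.sdiff_nonempty.2 hss.2
    have h1 := hmono {i} (S 1) (Finset.singleton_subset_iff.2 (Finset.mem_sdiff.1 hi).1)
    have h2 : 0 < dualProb μ (S 1) - dualProb μ (S 0) := by
      rw [hS.zero, hν.1, sub_zero]
      exact (hpos i).trans_le h1
    exact div_pos h2 (by exact_mod_cast Finset.card_pos.2 ⟨i, hi⟩)
  · refine IsGreatest.csSup_eq ⟨⟨p, hpmem, rfl⟩, ?_⟩
    rintro _ ⟨q, hq, rfl⟩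
    rcases eq_or_ne q p with rfl | hqp
    · exact le_rfl
    · exact (hmax q hq hqp).le
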